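/- Let $p,q\ge 0$, let $\mathrm{Cl}_{p,q}$ be the real Clifford algebra with generators $e_1,\dots,e_{p+q}$, where $e_i^2=1$ for $i\le p$, $e_i^2=-1$ for $i>p$, and $e_ie_j=-e_je_i$ for $i\ne j$. For $S\subseteq\{1,\dots,p+q\}$ let $e_S$ be the product of the $e_i$, $i\in S$, in increasing order; the $e_S$ form a basis, and $\langle A\rangle_0$ denotes the coefficient of $e_\emptyset=1$ in $A$. For $K\subseteq\{1,\dots,p+q\}$ let $\pi_K$ be the linear map to real matrices of size $2^{|K|}$, with rows and columns indexed by the subsets $M,N$ of $K$, that sends $e_S$ to the matrix with entries $\langle e_Me_M\rangle_0\,[e_S](e_Me_N)$, where $[e_S](x)$ is the coefficient of $e_S$ in $x$ (on the subalgebra generated by the $e_i$, $i\in K$, this is the real regular matrix representation). Let $A\in\mathrm{Cl}_{p,q}$, let $J$ be a set of $s$ indices such that every $e_S$ with non-zero coefficient in $A$ has $S\subseteq J$ (for instance, the set of all generators that occur in $A$), and put $k=2^{\lceil s/2\rceil}$. Define $m_0=1$ and, for $j=1,\dots,k$, $$t_j=\frac kj\,\langle A\,m_{j-1}\rangle_0,\qquad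 c_j=-t_j,\qquad m_j=A\,m_{j-1}-t_j .$$ Then: 1. $m_k=0$. 2. The polynomial $p_A(\lambda)=\lambda^k+c_1\lambda^{k-1}+\dots+c_{k-1}\lambda+c_k$ is the reduced characteristic polynomial of $A$, that is, the monic real polynomial of degree $k$ with $\det(\lambda I-\pi_K(A))=p_A(\lambda)^{2^{|K|}/k}$ for every $K\supseteq J$ (in particular for $K=J$ and for $K=\{1,\dots,p+q\}$). Moreover $\det\pi_K(A)=\big((-1)^kc_k\big)^{2^{|K|}/k}$ for all these $K$. 3. $A$ is invertible in $\mathrm{Cl}_{p,q}$ if and only if $c_k\neq0$. In that case $A^{-1}=-m_{k-1}/c_k$ (as a two-sided inverse), and $m_j\ne0$ for all $j<k$, so that $k$ is the first step at which the recursion reaches $0$. -/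

import Mathlib

namespace CliffordFVS

noncomputable section

/-- Squares of the generators: the first `p` are `+1`, the remaining `q` are `-1`. -/
def signature (p q : ℕ) (i : Fin (p + q)) : ℝ := if (i : ℕ) < p then 1 else -1

/-- The non-degenerate diagonal quadratic form of signature `(p, q)` on `ℝ^(p+q)`. -/
abbrev form (p q : ℕ) : QuadraticForm ℝ (Fin (p + q) → ℝ) :=
  QuadraticMap.weightedSumSquares ℝ (signature p q)

/-- The real Clifford algebra `Cl_{p,q}`. -/
abbrev Cl (p q : ℕ) : Type := CliffordAlgebra (form p q)

/-- The generator `e_i`. -/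
def gen {p q : ℕ} (i : Fin (p + q)) : Cl p q := CliffordAlgebra.ι (form p q) (Pi.single i 1)

/-- The blade `e_S`: the product of the generators `e_i`, `i ∈ S`, in increasing order. -/
def blade {p q : ℕ} (S : Finset (Fin (p + q))) : Cl p q :=
  ((S.sort (· ≤ ·)).map gen).prod

/-- The basis of `Cl p q` transported from the standard basis of the exterior algebra.  It consists
of the blades; see `bladeBasis_apply`. -/
def bladeBasis (p q : ℕ) : Module.Basis (Finset (Fin (p + q))) ℝ (Cl p q) :=
  (Pi.basisFun ℝ (Fin (p + q))).ExteriorAlgebra.map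
    (CliffordAlgebra.equivExterior (form p q)).symm

theorem gen_sq {p q : ℕ} (i : Fin (p + q)) :
    (gen i : Cl p q) * gen i = algebraMap ℝ _ (signature p q i) := by
  unfold gen
  rw [CliffordAlgebra.ι_sq_scalar]
  congr 1
  simp [QuadraticMap.weightedSumSquares_apply, Pi.single_apply]

theorem polar_gen {p q : ℕ} {i j : Fin (p + q)} (h : i ≠ j) :
    QuadraticMap.polar (form p q) (Pi.single i 1) (Pi.single j 1) = 0 := by
  simp only [QuadraticMap.polar, QuadraticMap.weightedSumSquares_apply, Pi.add_apply,
    ← Finset.sum_sub_distrib]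
  refine Finset.sum_eq_zero fun x _ => ?_
  by_cases hi : x = i
  · subst hi
    simp [h]
  · simp [hi]

theorem contract_prod_eq_zero {M : Type*} [AddCommGroup M] [Module ℝ M] (Q : QuadraticForm ℝ M)
    (d : Module.Dual ℝ M) (l : List M) (h : ∀ v ∈ l, d v = 0) :
    CliffordAlgebra.contractLeft d ((l.map (CliffordAlgebra.ι Q)).prod) = 0 := by
  induction l with
  | nil => simp
  | cons v l ih =>
    rw [List.map_cons, List.prod_cons, CliffordAlgebra.contractLeft_ι_mul,
      ih fun w hw => h w (List.mem_cons_of_mem _ hw), h v List.mem_cons_self]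
    simp

theorem equivExterior_prod {p q : ℕ} (l : List (Fin (p + q))) (hl : l.Nodup) :
    CliffordAlgebra.equivExterior (form p q) ((l.map gen).prod) =
      (l.map fun i => ExteriorAlgebra.ι ℝ (Pi.single i (1 : ℝ) : Fin (p + q) → ℝ)).prod := by
  induction l with
  | nil => simp
  | cons i l ih =>
    rw [List.nodup_cons] at hl
    have ih' := ih hl.2
    simp only [CliffordAlgebra.equivExterior, CliffordAlgebra.changeFormEquiv_apply] at ih' ⊢
    rw [List.map_cons, List.prod_cons, gen, CliffordAlgebra.changeForm_ι_mul, ih', List.map_cons,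
      List.prod_cons]
    have h0 := contract_prod_eq_zero (0 : QuadraticForm ℝ (Fin (p + q) → ℝ))
      ((QuadraticMap.associated (R := ℝ) (-(form p q))) (Pi.single i 1))
      (l.map fun j => Pi.single j (1 : ℝ)) (by
        intro v hv
        obtain ⟨j, hj, rfl⟩ := List.mem_map.1 hv
        have hij : i ≠ j := fun h => hl.1 (h ▸ hj)
        have := polar_gen hij
        simp only [map_neg, LinearMap.neg_apply, neg_eq_zero]
        rw [QuadraticMap.associated_apply]
        simp only [QuadraticMap.polar] at this
        rw [this]
        simp)
    rw [List.map_map] at h0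
    erw [h0]
    rw [sub_zero]

theorem bladeBasis_apply {p q : ℕ} (S : Finset (Fin (p + q))) :
    bladeBasis p q S = blade S := by
  unfold bladeBasis
  rw [Module.Basis.map_apply, LinearEquiv.symm_apply_eq, blade,
    equivExterior_prod _ (Finset.sort_nodup _ _), ExteriorAlgebra.basis_apply]
  simp only [ExteriorAlgebra.ιMulti_family, ExteriorAlgebra.ιMulti_apply]
  rw [← Finset.listMap_orderEmbOfFin_finRange S rfl, List.ofFn_eq_map, List.map_map]
  congr 1
  refine List.map_congr_left fun i _ => ?_
  simp
  rfl

/-- The coefficient `a_S` of the blade `e_S` in `A = ∑ a_S e_S`. -/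
def coeff {p q : ℕ} (S : Finset (Fin (p + q))) (A : Cl p q) : ℝ := (bladeBasis p q).repr A S

/-- The scalar part `⟨A⟩₀`, i.e. the coefficient of the empty blade `1`. -/
def scalarPart {p q : ℕ} (A : Cl p q) : ℝ := coeff ∅ A

open Classical in
/-- The generators occurring in `A`: those `e_i` for which some blade `e_S` with `i ∈ S` has a
non-zero coefficient in `A`. -/
def generators {p q : ℕ} (A : Cl p q) : Finset (Fin (p + q)) :=
  Finset.univ.filter fun i => ∃ S, i ∈ S ∧ coeff S A ≠ 0

/-- The scalar product matrix `⟨e_M e_N⟩₀` of the blades with indices in `K`; it is diagonal with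
entries `±1`. -/
def scalarProductMatrix {p q : ℕ} (K : Finset (Fin (p + q))) :
    Matrix K.powerset K.powerset ℝ :=
  Matrix.of fun M N => scalarPart (blade (M : Finset (Fin (p + q))) * blade (N : Finset _))

/-- The matrix of the coefficients of `e_S` in the multiplication table of the blades with indices
in `K`. -/
def coeffMatrix {p q : ℕ} (K S : Finset (Fin (p + q))) : Matrix K.powerset K.powerset ℝ :=
  Matrix.of fun M N => coeff S (blade (M : Finset (Fin (p + q))) * blade (N : Finset _))

/-- The canonical real matrix map for the blades with indices in `K`: the linear map that sends
`e_S` to the product of the scalar product matrix and the coefficient matrix of `e_S`.  For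
`K = univ` this is the regular representation of `Cl p q` by matrices of size `2^(p+q)`; for smaller
`K` it represents the subalgebra generated by the `e_i`, `i ∈ K`, by matrices of size `2^|K|`. -/
def matrixRep {p q : ℕ} (K : Finset (Fin (p + q))) (A : Cl p q) :
    Matrix K.powerset K.powerset ℝ :=
  ∑ S : Finset (Fin (p + q)), coeff S A • (scalarProductMatrix K * coeffMatrix K S)

/-- The multivectors of the recursion with parameter `k`: `m_0 = 1` and
`m_j = A m_{j-1} - t_j` with `t_j = (k / j) ⟨A m_{j-1}⟩₀`. -/
def fvsM {p q : ℕ} (k : ℕ) (A : Cl p q) : ℕ → Cl p q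
  | 0 => 1
  | j + 1 => A * fvsM k A j -
      algebraMap ℝ (Cl p q) ((k : ℝ) / ((j + 1 : ℕ) : ℝ) * scalarPart (A * fvsM k A j))

/-- The coefficients of the recursion: `c_0 = 1` and `c_j = -t_j = -(k / j) ⟨A m_{j-1}⟩₀`. -/
def fvsC {p q : ℕ} (k : ℕ) (A : Cl p q) : ℕ → ℝ
  | 0 => 1
  | j + 1 => -((k : ℝ) / ((j + 1 : ℕ) : ℝ) * scalarPart (A * fvsM k A j))

/-- The polynomial `λ^k + c_1 λ^(k-1) + ⋯ + c_(k-1) λ + c_k` produced by the recursion. -/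
def fvsPoly {p q : ℕ} (k : ℕ) (A : Cl p q) : Polynomial ℝ :=
  ∑ j ∈ Finset.range (k + 1), Polynomial.C (fvsC k A j) * Polynomial.X ^ (k - j)

/-- The number of steps `2^⌈s/2⌉`. -/
def numSteps (s : ℕ) : ℕ := 2 ^ ((s + 1) / 2)

/-- `f` is the reduced characteristic polynomial of `A`, considered as an element of the subalgebra
generated by the `e_i`, `i ∈ J`: it is monic of degree `k = 2^⌈|J|/2⌉`, and the characteristic
polynomial `det(λ - π_K(A))` of every real matrix representation `π_K` with `J ⊆ K` is a power
of `f` (by degree, the power with exponent `2^|K| / k`, where `k` divides `2^|K|`). -/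
structure IsReducedCharpoly {p q : ℕ} (J : Finset (Fin (p + q))) (A : Cl p q)
    (f : Polynomial ℝ) : Prop where
  monic : f.Monic
  natDegree_eq : f.natDegree = numSteps J.card
  charpoly_eq : ∀ K : Finset (Fin (p + q)), J ⊆ K →
    (matrixRep K A).charpoly = f ^ (2 ^ K.card / numSteps J.card)

end

end CliffordFVS

/-!
Why the theorem holds. The generators in `J` can be realised by anticommuting complex matrices of
size `k = 2^⌈|J|/2⌉` for which all products of distinct generators are traceless
(`exists_traceless_matrices`). Extending linearly over the blades gives a map `bladeMap` from the
Clifford algebra to `k × k` matrices that is multiplicative on the subalgebra generated by the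
`e_i`, `i ∈ J` (`bladeMap_mul`), satisfies `tr (bladeMap X) = k ⟨X⟩₀` (`trace_bladeMap`), and is
therefore injective on that subalgebra (`eq_zero_of_bladeMap_eq_zero`).

The trace identity turns the recursion for `A` into the Faddeev–LeVerrier recursion for the matrix
`bladeMap A` (`bladeMap_fvsM`). The latter produces the coefficients of the characteristic
polynomial and reaches `0` after `k` steps (`leverrier_spec`): its matrices are the coefficients of
the adjugate of `X - M`, whose trace is the derivative of the characteristic polynomial. So the
polynomial of the recursion is the characteristic polynomial of `bladeMap A`, and `m_k = 0` by
injectivity.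

The real matrix `π_K(A)` is the matrix of right multiplication by `A` on the blades with indices in
`K` (`matrixRep_apply`), so `tr (π_K(A)^j) = 2^|K| ⟨A^j⟩₀`. These are the power traces of
`2^|K| / k` diagonal copies of `bladeMap A`, and power traces determine the characteristic
polynomial (`charpoly_eq_of_trace_pow_eq`, `charpoly_matrixRep`).

For the last part, `0 = m_k = A m_{k-1} + c_k` gives the inverse when `c_k ≠ 0`; conversely
`c_k = ± det (bladeMap A)`, which is non-zero when `A` has an inverse anywhere in the algebra.
-/

namespace CliffordFVS

open Matrix Polynomial
open scoped symmDiff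

/-! ### The Faddeev–LeVerrier recursion for matrices -/

section Leverrier

variable {n R : Type*} [Fintype n] [DecidableEq n]

/-- The trace of the adjugate of `X - M` is the derivative of the characteristic polynomial: both
are sums of the diagonal minors of `X - M`. -/
theorem trace_adjugate_charmatrix [CommRing R] (M : Matrix n n R) :
    (adjugate (charmatrix M)).trace = derivative M.charpoly := by
  have hd : ∀ a b, derivative (charmatrix M a b) = if a = b then 1 else 0 := by
    intro a b
    by_cases h : a = b
    · subst h; simp [charmatrix_apply_eq]
    · simp [h]
  have hadj : ∀ i, adjugate (charmatrix M) i i = ∑ σ : Equiv.Perm n,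
      (Equiv.Perm.sign σ : ℤ) • ((∏ j ∈ Finset.univ.erase i, charmatrix M (σ j) j) *
        derivative (charmatrix M (σ i) i)) := by
    intro i
    rw [← transpose_apply (adjugate _), adjugate_transpose, adjugate_apply, updateRow_transpose,
      det_transpose, det_apply]
    refine Finset.sum_congr rfl fun σ _ => ?_
    rw [hd, ← Finset.prod_erase_mul _ _ (Finset.mem_univ i)]
    congr 2
    · refine Finset.prod_congr rfl fun j hj => ?_
      rw [updateCol_ne (Finset.ne_of_mem_erase hj)]
    · simp [Pi.single_apply]
  simp only [Matrix.trace, diag_apply, hadj]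
  rw [Finset.sum_comm, charpoly, det_apply, derivative_sum]
  refine Finset.sum_congr rfl fun σ _ => ?_
  rw [← Finset.smul_sum, ← derivative_prod_finset]
  simp [Units.smul_def]

/-- The coefficients `a i` of the adjugate of `X - M`, as a polynomial with matrix coefficients.
The recursion compares coefficients in `(X - M) adj(X - M) = charpoly M`, and the traces come from
`trace_adjugate_charmatrix`. -/
theorem exists_adjugate_coeff [CommRing R] (M : Matrix n n R) :
    ∃ a : ℕ → Matrix n n R, (∀ i, Fintype.card n ≤ i → a i = 0) ∧
      (∀ i, a i = M * a (i + 1) + algebraMap R _ (M.charpoly.coeff (i + 1))) ∧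
      M * a 0 + algebraMap R _ (M.charpoly.coeff 0) = 0 ∧
      ∀ i, (a i).trace = (i + 1) * M.charpoly.coeff (i + 1) := by
  set A := matPolyEquiv (adjugate (charmatrix M)) with hA
  have hmul : (X - C M) * A = M.charpoly.map (algebraMap R _) := by
    rw [hA, ← matPolyEquiv_charmatrix, ← map_mul, mul_adjugate]
    exact matPolyEquiv_smul_one _
  have h0 : M * A.coeff 0 + algebraMap R _ (M.charpoly.coeff 0) = 0 := by
    have := congrArg (fun f => Polynomial.coeff f 0) hmul
    simp [sub_mul] at this
    rw [← this]; simp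
  have h1 : ∀ i, A.coeff i = M * A.coeff (i + 1) +
      algebraMap R _ (M.charpoly.coeff (i + 1)) := by
    intro i
    have := congrArg (fun f => Polynomial.coeff f (i + 1)) hmul
    simp only [sub_mul, coeff_sub, coeff_X_mul, coeff_C_mul, coeff_map] at this
    rw [← this]; abel
  have htop : ∀ i, Fintype.card n ≤ i → A.coeff i = 0 := by
    intro i hi
    -- Beyond the degree of `charpoly M` the recursion reads `a j = M a (j + 1)`, and `a` is
    -- eventually zero.
    have : ∀ d j, Fintype.card n ≤ j → A.natDegree < j + d → A.coeff j = 0 := by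
      intro d
      induction d with
      | zero => intro j _ h; exact coeff_eq_zero_of_natDegree_lt (by omega)
      | succ d ih =>
        intro j hj h
        nontriviality R
        rw [h1, ih (j + 1) (by omega) (by omega), coeff_eq_zero_of_natDegree_lt (p := M.charpoly)]
        · simp
        · rw [charpoly_natDegree_eq_dim]; omega
    exact this (A.natDegree + 1) i hi (by omega)
  refine ⟨A.coeff, htop, h1, h0, fun i => ?_⟩
  have : ((A.coeff i).trace : R) = (adjugate (charmatrix M)).trace.coeff i := by
    simp [Matrix.trace, hA, matPolyEquiv_coeff_apply]
  rw [this, trace_adjugate_charmatrix, coeff_derivative, mul_comm]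

/-- The matrices of the Faddeev–LeVerrier recursion: `N_0 = 1` and
`N_{j+1} = M N_j - tr(M N_j) / (j + 1)`. -/
noncomputable def leverrier [Field R] (M : Matrix n n R) : ℕ → Matrix n n R
  | 0 => 1
  | j + 1 => M * leverrier M j - algebraMap R _ (((j + 1 : ℕ) : R)⁻¹ * (M * leverrier M j).trace)

/-- The recursion yields the coefficients of the characteristic polynomial and ends with `0`:
`leverrier M j` is the coefficient of index `n - 1 - j` of the adjugate of `X - M`. -/
theorem leverrier_spec [Field R] [CharZero R] (M : Matrix n n R) :
    (∀ j < Fintype.card n, M.charpoly.coeff (Fintype.card n - (j + 1)) =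
      -(((j + 1 : ℕ) : R)⁻¹ * (M * leverrier M j).trace)) ∧
    leverrier M (Fintype.card n) = 0 := by
  obtain ⟨a, htop, hrec, h0, htr⟩ := exists_adjugate_coeff M
  have hc : M.charpoly.coeff (Fintype.card n) = 1 := by
    have := M.charpoly_monic.coeff_natDegree
    rwa [charpoly_natDegree_eq_dim] at this
  -- For the coefficients `f_i` of `charpoly M`, `tr (a (i - 1)) = i f_i` and
  -- `a (i - 1) = M a i + f_i`, whence
  -- `(n - i) f_i = -tr (M a i)`.
  have hcoeff : ∀ j i, j + 1 + i = Fintype.card n → leverrier M j = a i →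
      M.charpoly.coeff i = -(((j + 1 : ℕ) : R)⁻¹ * (M * leverrier M j).trace) := by
    intro j i hji hj
    have hn : ((j + 1 : ℕ) : R) ≠ 0 := Nat.cast_ne_zero.mpr (by omega)
    have hcard : (Fintype.card n : R) = (j + 1 : ℕ) + i := by rw [← hji]; push_cast; ring
    have key : (M * a i).trace = -((j + 1 : ℕ) : R) * M.charpoly.coeff i := by
      cases i with
      | zero =>
        rw [eq_neg_of_add_eq_zero_left h0]
        simp [Algebra.algebraMap_eq_smul_one, hcard]
        ring
      | succ i =>
        have h := htr i
        rw [hrec, trace_add] at h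
        simp only [Algebra.algebraMap_eq_smul_one, trace_smul, trace_one, smul_eq_mul, hcard] at h
        push_cast at h ⊢
        linear_combination h
    rw [hj, key]; field_simp
  have hstep : ∀ j i, j + 1 + i = Fintype.card n → leverrier M j = a i := by
    intro j
    induction j with
    | zero =>
      intro i hi
      rw [hrec i, htop (i + 1) (by omega), show i + 1 = Fintype.card n by omega, hc]
      simp [leverrier]
    | succ j ih =>
      intro i hi
      have hj := ih (i + 1) (by omega)
      rw [leverrier, sub_eq_add_neg, ← map_neg, ← hcoeff j (i + 1) (by omega) hj, hj, ← hrec]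
  refine ⟨fun j hj => hcoeff j _ (by omega) (hstep j _ (by omega)), ?_⟩
  rcases hn : Fintype.card n with _ | j
  · have := Fintype.card_eq_zero_iff.mp hn
    exact Subsingleton.elim _ _
  · have hj := hstep j 0 (by omega)
    rw [leverrier, sub_eq_add_neg, ← map_neg, ← hcoeff j 0 (by omega) hj, hj, h0]

/-- In characteristic zero the traces of the powers of a matrix determine its characteristic
polynomial. -/
theorem charpoly_eq_of_trace_pow_eq [Field R] [CharZero R] {m : Type*} [Fintype m] [DecidableEq m]
    (M : Matrix n n R) (M' : Matrix m m R) (h : ∀ j, (M ^ j).trace = (M' ^ j).trace) :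
    M.charpoly = M'.charpoly := by
  have hcard : Fintype.card n = Fintype.card m := by
    -- The trace of the zeroth power is the size of the matrix.
    simpa using h 0
  have htr : ∀ P : R[X], (aeval M P).trace = (aeval M' P).trace := by
    intro P
    simp [aeval_eq_sum_range, trace_sum, h]
  -- Both recursions are given by the same polynomials in the two matrices.
  have hP : ∀ j, ∃ P : R[X], leverrier M j = aeval M P ∧ leverrier M' j = aeval M' P := by
    intro j
    induction j with
    | zero => exact ⟨1, by simp [leverrier]⟩
    | succ j ih =>
      obtain ⟨P, h1, h2⟩ := ih
      refine ⟨X * P - C (((j + 1 : ℕ) : R)⁻¹ * (aeval M (X * P)).trace), ?_, ?_⟩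
      · simp [leverrier, h1]
      · rw [htr]; simp [leverrier, h2]
  have hlow : ∀ j < Fintype.card n, M.charpoly.coeff j = M'.charpoly.coeff j := by
    intro j hj
    obtain ⟨P, h1, h2⟩ := hP (Fintype.card n - (j + 1))
    have e1 := (leverrier_spec M).1 (Fintype.card n - (j + 1)) (by omega)
    have e2 := (leverrier_spec M').1 (Fintype.card n - (j + 1)) (by omega)
    rw [← hcard] at e2
    rw [show Fintype.card n - (Fintype.card n - (j + 1) + 1) = j by omega] at e1 e2
    have ht := htr (X * P)
    rw [map_mul, map_mul, aeval_X, aeval_X] at ht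
    rw [e1, e2, h1, h2, ht]
  have hM := M.charpoly_monic
  have hM' := M'.charpoly_monic
  ext j
  rcases lt_trichotomy j (Fintype.card n) with hj | rfl | hj
  · exact hlow j hj
  · have e1 := hM.coeff_natDegree
    have e2 := hM'.coeff_natDegree
    rw [charpoly_natDegree_eq_dim] at e1 e2
    rw [e1, hcard, e2]
  · rw [coeff_eq_zero_of_natDegree_lt, coeff_eq_zero_of_natDegree_lt]
    · rwa [charpoly_natDegree_eq_dim, ← hcard]
    · rwa [charpoly_natDegree_eq_dim]

theorem charpoly_blockDiagonal_const [CommRing R] (o : Type*) [Fintype o] [DecidableEq o]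
    (M : Matrix n n R) :
    (blockDiagonal fun _ : o => M).charpoly = M.charpoly ^ Fintype.card o := by
  have : charmatrix (blockDiagonal fun _ : o => M) = blockDiagonal fun _ : o => charmatrix M := by
    ext ⟨i, a⟩ ⟨j, b⟩
    by_cases hab : a = b <;> by_cases hij : i = j <;>
      simp [blockDiagonal_apply, hab, hij]
  rw [charpoly, this, det_blockDiagonal]
  simp [charpoly]

end Leverrier

/-! ### Ordered products of anticommuting elements -/

/-- The product of the elements `γ i`, `i ∈ S`, in increasing order. -/
def bladeProd {R : Type*} [Ring R] {n : ℕ} (γ : Fin n → R) (S : Finset (Fin n)) : R :=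
  ((S.sort (· ≤ ·)).map γ).prod

/-- The scalar `c` with `γ_i γ_S = c γ_(S ∆ {i})`, for anticommuting `γ_i` with `γ_i² = sig i`. -/
noncomputable def genSign {n : ℕ} (sig : Fin n → ℝ) (i : Fin n) (S : Finset (Fin n)) : ℝ :=
  (-1) ^ (S.filter (· < i)).card * if i ∈ S then sig i else 1

section BladeProd

variable {R : Type*} [Ring R] {n : ℕ} (γ : Fin n → R)

@[simp] theorem bladeProd_empty : bladeProd γ ∅ = 1 := by simp [bladeProd]

theorem bladeProd_insert {a : Fin n} {T : Finset (Fin n)} (h : ∀ b ∈ T, a < b) :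
    bladeProd γ (insert a T) = γ a * bladeProd γ T := by
  rw [bladeProd, Finset.sort_insert _ (fun b hb => (h b hb).le) (fun ha => (h a ha).false),
    List.map_cons, List.prod_cons, bladeProd]

theorem bladeProd_eq_zero {S : Finset (Fin n)} {i : Fin n} (hi : i ∈ S) (h : γ i = 0) :
    bladeProd γ S = 0 := by
  rw [bladeProd]
  exact List.prod_eq_zero (List.mem_map.2 ⟨i, by simpa using hi, h⟩)

variable [Algebra ℝ R]

theorem mul_bladeProd_comm (g : R) (ε : Fin n → ℝ) (S : Finset (Fin n))
    (h : ∀ i ∈ S, g * γ i = ε i • (γ i * g)) :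
    g * bladeProd γ S = (∏ i ∈ S, ε i) • (bladeProd γ S * g) := by
  induction S using Finset.induction_on_min with
  | empty => simp
  | insert a T hT ih =>
    rw [bladeProd_insert γ hT, ← mul_assoc, h a (Finset.mem_insert_self _ _), smul_mul_assoc,
      mul_assoc, ih fun i hi => h i (Finset.mem_insert_of_mem hi),
      Finset.prod_insert fun ha => (hT a ha).false]
    simp only [mul_smul_comm, smul_smul, mul_assoc]

/-- The sign depends on `i` and `S` only, not on the ring, so it is the same in the Clifford algebra
and in a matrix realisation of the relations. -/
theorem mul_bladeProd (sig : Fin n → ℝ) (i : Fin n) (hsq : γ i * γ i = algebraMap ℝ R (sig i))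
    (hanti : ∀ j, j ≠ i → γ i * γ j = -(γ j * γ i)) (S : Finset (Fin n)) :
    γ i * bladeProd γ S = genSign sig i S • bladeProd γ (S ∆ {i}) := by
  induction S using Finset.induction_on_min with
  | empty =>
    have h : (∅ : Finset (Fin n)) ∆ {i} = insert i ∅ := by ext; simp [Finset.mem_symmDiff]
    rw [h, bladeProd_insert γ (by simp)]
    simp [genSign]
  | insert a T hT ih =>
    rcases lt_trichotomy i a with hia | rfl | hia
    · have hlt : ∀ b ∈ insert a T, i < b := by
        intro b hb
        rcases Finset.mem_insert.1 hb with rfl | hb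
        · exact hia
        · exact hia.trans (hT b hb)
      have hi : i ∉ insert a T := fun h => (hlt i h).false
      have h : insert a T ∆ {i} = insert i (insert a T) := by
        ext x; by_cases hx : x = i
        · subst hx; simp [Finset.mem_symmDiff, hi]
        · simp [Finset.mem_symmDiff, hx]
      have hf : (insert a T).filter (· < i) = ∅ :=
        Finset.filter_eq_empty_iff.2 fun b hb => (hlt b hb).not_gt
      rw [h, bladeProd_insert γ hlt, genSign, hf, if_neg hi]
      simp
    · have hi : i ∉ T := fun h => (hT i h).false
      have h : insert i T ∆ {i} = T := by
        ext x; by_cases hx : x = i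
        · subst hx; simp [Finset.mem_symmDiff, hi]
        · simp [Finset.mem_symmDiff, hx]
      have hf : (insert i T).filter (· < i) = ∅ := by
        refine Finset.filter_eq_empty_iff.2 fun b hb => ?_
        rcases Finset.mem_insert.1 hb with rfl | hb
        · exact lt_irrefl _
        · exact (hT b hb).not_gt
      rw [h, bladeProd_insert γ hT, genSign, hf, if_pos (Finset.mem_insert_self _ _),
        ← mul_assoc, hsq, ← Algebra.smul_def]
      simp
    · have ha : a ∉ T := fun h => (hT a h).false
      have hlt : ∀ b ∈ T ∆ {i}, a < b := by
        intro b hb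
        rcases Finset.mem_symmDiff.1 hb with ⟨hb, _⟩ | ⟨hb, _⟩
        · exact hT b hb
        · rwa [Finset.mem_singleton.1 hb]
      have h : insert a T ∆ {i} = insert a (T ∆ {i}) := by
        ext x; by_cases hx : x = a
        · subst hx; simp [Finset.mem_symmDiff, hia.ne]
        · simp [Finset.mem_symmDiff, hx]
      have hf : ((insert a T).filter (· < i)).card = (T.filter (· < i)).card + 1 := by
        rw [Finset.filter_insert, if_pos hia, Finset.card_insert_of_notMem (by simp [ha])]
      have hs : genSign sig i (insert a T) = -genSign sig i T := by
        simp only [genSign, hf, Finset.mem_insert, hia.ne', false_or, pow_succ]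
        ring
      rw [h, bladeProd_insert γ hT, bladeProd_insert γ hlt, ← mul_assoc, hanti a hia.ne, neg_mul,
        mul_assoc, ih, hs, mul_smul_comm, neg_smul]

end BladeProd

/-! ### Products of blades -/

variable {p q : ℕ}

theorem signature_mul_self (i : Fin (p + q)) : signature p q i * signature p q i = 1 := by
  unfold signature; split_ifs <;> norm_num

theorem genSign_mul_self (i : Fin (p + q)) (S : Finset (Fin (p + q))) :
    genSign (signature p q) i S * genSign (signature p q) i S = 1 := by
  rw [genSign, mul_mul_mul_comm, ← mul_pow]
  split_ifs <;> simp [signature_mul_self]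

theorem gen_mul_gen {i j : Fin (p + q)} (h : j ≠ i) :
    (gen i * gen j : Cl p q) = -(gen j * gen i) := by
  have := CliffordAlgebra.ι_mul_ι_add_swap (Q := form p q) (Pi.single i (1 : ℝ)) (Pi.single j 1)
  rw [polar_gen h.symm, map_zero] at this
  exact eq_neg_of_add_eq_zero_left this

theorem blade_eq_bladeProd (S : Finset (Fin (p + q))) : (blade S : Cl p q) = bladeProd gen S := rfl

theorem gen_mul_blade (i : Fin (p + q)) (S : Finset (Fin (p + q))) :
    (gen i * blade S : Cl p q) = genSign (signature p q) i S • blade (S ∆ {i}) :=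
  mul_bladeProd gen (signature p q) i (gen_sq i) (fun _ h => gen_mul_gen h) S

@[simp] theorem blade_empty : (blade ∅ : Cl p q) = 1 := bladeProd_empty gen

/-- The product of two blades is, up to sign, the blade of the symmetric difference. -/
theorem exists_blade_mul_blade (M N : Finset (Fin (p + q))) :
    ∃ c : ℝ, c * c = 1 ∧ (blade M * blade N : Cl p q) = c • blade (M ∆ N) := by
  induction M using Finset.induction_on_min with
  | empty => exact ⟨1, by simp, by rw [show ∅ ∆ N = N from bot_symmDiff N]; simp⟩
  | insert a T hT ih =>
    obtain ⟨c, hc, h⟩ := ih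
    have ha : a ∉ T := fun h => (hT a h).false
    refine ⟨c * genSign (signature p q) a (T ∆ N), ?_, ?_⟩
    · rw [mul_mul_mul_comm, hc, genSign_mul_self, mul_one]
    · have hs : insert a T ∆ N = (T ∆ N) ∆ {a} := by
        ext x; by_cases hx : x = a
        · subst hx; simp [Finset.mem_symmDiff, ha]
        · simp [Finset.mem_symmDiff, hx]
      rw [blade_eq_bladeProd, bladeProd_insert _ hT, ← blade_eq_bladeProd, mul_assoc, h,
        mul_smul_comm, gen_mul_blade, smul_smul, hs]

theorem coeff_blade (S T : Finset (Fin (p + q))) :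
    coeff S (blade T : Cl p q) = if T = S then 1 else 0 := by
  rw [coeff, ← bladeBasis_apply, Module.Basis.repr_self, Finsupp.single_apply]

/-- The coefficient of the blade `e_S`, as a linear form. -/
noncomputable def coeffₗ (S : Finset (Fin (p + q))) : Cl p q →ₗ[ℝ] ℝ := (bladeBasis p q).coord S

theorem coeffₗ_apply (S : Finset (Fin (p + q))) (A : Cl p q) : coeffₗ S A = coeff S A := rfl

@[simp] theorem coeff_smul (S : Finset (Fin (p + q))) (c : ℝ) (A : Cl p q) :
    coeff S (c • A) = c * coeff S A := (coeffₗ S).map_smul c A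

theorem sum_coeff_smul_blade (A : Cl p q) : ∑ S, coeff S A • blade S = A := by
  simp_rw [← bladeBasis_apply]
  exact (bladeBasis p q).sum_repr A

theorem scalarPart_one : scalarPart (1 : Cl p q) = 1 := by
  rw [scalarPart, ← blade_empty, coeff_blade, if_pos rfl]

theorem linearMap_ext_blade {V : Type*} [AddCommMonoid V] [Module ℝ V] {f g : Cl p q →ₗ[ℝ] V}
    (h : ∀ S, f (blade S) = g (blade S)) (X : Cl p q) : f X = g X := by
  rw [(bladeBasis p q).ext (f₁ := f) (f₂ := g) fun S => by rw [bladeBasis_apply]; exact h S]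

/-- In `e_M X` only the scalar part of `X` contributes to the coefficient of `e_M`; hence the
diagonal entries of the regular representation are all equal to `⟨X⟩₀`. -/
theorem coeff_blade_mul_self (M : Finset (Fin (p + q))) (X : Cl p q) :
    coeff M (blade M * X) = scalarPart X := by
  refine linearMap_ext_blade (f := coeffₗ M ∘ₗ LinearMap.mulLeft ℝ (blade M)) (g := coeffₗ ∅)
    (fun S => ?_) X
  simp only [LinearMap.comp_apply, LinearMap.mulLeft_apply, coeffₗ_apply]
  rcases eq_or_ne S ∅ with rfl | hS
  · simp only [blade_empty, mul_one]
    rw [← blade_empty, coeff_blade, coeff_blade, if_pos rfl, if_pos rfl]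
  · obtain ⟨c, -, h⟩ := exists_blade_mul_blade M S
    rw [h, coeff_smul, coeff_blade, coeff_blade, if_neg hS, if_neg, mul_zero]
    simpa [symmDiff_eq_left] using hS

/-- The bilinear form `⟨X Y⟩₀` is diagonal in the basis of blades. -/
theorem scalarPart_blade_mul (S : Finset (Fin (p + q))) (X : Cl p q) :
    scalarPart (blade S * X) = scalarPart (blade S * blade S : Cl p q) * coeff S X := by
  refine linearMap_ext_blade (f := coeffₗ ∅ ∘ₗ LinearMap.mulLeft ℝ (blade S))
    (g := scalarPart (blade S * blade S : Cl p q) • coeffₗ S) (fun T => ?_) X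
  simp only [LinearMap.comp_apply, LinearMap.mulLeft_apply, LinearMap.smul_apply, coeffₗ_apply,
    smul_eq_mul]
  rcases eq_or_ne T S with rfl | hT
  · rw [coeff_blade, if_pos rfl, mul_one]; rfl
  · obtain ⟨c, -, h⟩ := exists_blade_mul_blade S T
    rw [h, coeff_smul, coeff_blade, coeff_blade, if_neg hT, if_neg]
    · simp
    · simpa [Finset.bot_eq_empty] using (symmDiff_eq_bot.not.2 hT.symm)

theorem blade_mul_self (S : Finset (Fin (p + q))) :
    (blade S * blade S : Cl p q) =
      algebraMap ℝ _ (scalarPart (blade S * blade S : Cl p q)) ∧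
    scalarPart (blade S * blade S : Cl p q) * scalarPart (blade S * blade S : Cl p q) = 1 := by
  obtain ⟨c, hc, h⟩ := exists_blade_mul_blade S S (p := p) (q := q)
  rw [symmDiff_self, Finset.bot_eq_empty, blade_empty] at h
  have hs : scalarPart (blade S * blade S : Cl p q) = c := by
    rw [h, scalarPart, coeff_smul]
    exact (congrArg (c * ·) scalarPart_one).trans (mul_one c)
  rw [hs, h, Algebra.algebraMap_eq_smul_one]
  exact ⟨rfl, hc⟩

/-! ### The subalgebra generated by some of the generators -/

/-- The subspace spanned by the blades `e_S` with `S ⊆ J`. -/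
def bladeSpan (J : Finset (Fin (p + q))) : Submodule ℝ (Cl p q) :=
  Submodule.span ℝ (blade '' {S | S ⊆ J})

theorem blade_mem_bladeSpan {J S : Finset (Fin (p + q))} (h : S ⊆ J) : blade S ∈ bladeSpan J :=
  Submodule.subset_span ⟨S, h, rfl⟩

theorem mem_bladeSpan_of_generators_subset {J : Finset (Fin (p + q))} {A : Cl p q}
    (h : generators A ⊆ J) : A ∈ bladeSpan J := by
  rw [← sum_coeff_smul_blade A]
  refine Submodule.sum_mem _ fun S _ => ?_
  by_cases hS : coeff S A = 0
  · simp [hS]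
  · refine Submodule.smul_mem _ _ (blade_mem_bladeSpan fun i hi => h ?_)
    exact Finset.mem_filter.2 ⟨Finset.mem_univ _, S, hi, hS⟩

theorem bladeSpan_mono {J K : Finset (Fin (p + q))} (h : J ⊆ K) :
    (bladeSpan J : Submodule ℝ (Cl p q)) ≤ bladeSpan K :=
  Submodule.span_mono (Set.image_mono fun _ hS => hS.trans h)

theorem coeff_eq_zero_of_mem_bladeSpan {J S : Finset (Fin (p + q))} {A : Cl p q}
    (hA : A ∈ bladeSpan J) (h : ¬S ⊆ J) : coeff S A = 0 := by
  rw [← coeffₗ_apply, ← LinearMap.mem_ker]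
  refine Submodule.span_le.2 ?_ hA
  rintro _ ⟨T, hT, rfl⟩
  rw [SetLike.mem_coe, LinearMap.mem_ker, coeffₗ_apply, coeff_blade, if_neg]
  rintro rfl
  exact h hT

theorem one_mem_bladeSpan (J : Finset (Fin (p + q))) : (1 : Cl p q) ∈ bladeSpan J := by
  rw [← blade_empty]; exact blade_mem_bladeSpan (Finset.empty_subset J)

theorem mul_mem_bladeSpan {J : Finset (Fin (p + q))} {A B : Cl p q} (hA : A ∈ bladeSpan J)
    (hB : B ∈ bladeSpan J) : A * B ∈ bladeSpan J := by
  induction hA, hB using Submodule.span_induction₂ with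
  | mem_mem x y hx hy =>
    obtain ⟨S, hS, rfl⟩ := hx
    obtain ⟨T, hT, rfl⟩ := hy
    obtain ⟨c, -, h⟩ := exists_blade_mul_blade S T (p := p) (q := q)
    rw [h]
    exact Submodule.smul_mem _ _ (blade_mem_bladeSpan
      (symmDiff_le_sup.trans (Finset.union_subset hS hT)))
  | zero_left y hy => simp
  | zero_right x hx => simp
  | add_left x y z _ _ _ h1 h2 => rw [add_mul]; exact add_mem h1 h2
  | add_right x y z _ _ _ h1 h2 => rw [mul_add]; exact add_mem h1 h2
  | smul_left r x y _ _ h => rw [smul_mul_assoc]; exact Submodule.smul_mem _ _ h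
  | smul_right r x y _ _ h => rw [mul_smul_comm]; exact Submodule.smul_mem _ _ h

/-! ### Complex matrices satisfying the Clifford relations -/

/-- There are `2n` anticommuting complex matrices of size `2^n` with square `1`: the matrices
`γ ⊗ σ_z` for `2n - 2` such matrices `γ` of half the size, together with `1 ⊗ σ_x`, `1 ⊗ σ_y`. -/
theorem exists_anticommuting_matrices (n : ℕ) : ∃ (I : Type) (_ : Fintype I) (_ : DecidableEq I)
    (Γ : Fin (2 * n) → Matrix I I ℂ), Fintype.card I = 2 ^ n ∧ (∀ i, Γ i * Γ i = 1) ∧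
      ∀ i j, j ≠ i → Γ i * Γ j = -(Γ j * Γ i) := by
  induction n with
  | zero => exact ⟨Unit, inferInstance, inferInstance, Fin.elim0, by simp, fun i => i.elim0,
      fun i => i.elim0⟩
  | succ n ih =>
    obtain ⟨I, _, _, Γ, hcard, hsq, hanti⟩ := ih
    let x : Matrix (I ⊕ I) (I ⊕ I) ℂ := fromBlocks 0 1 1 0
    let y : Matrix (I ⊕ I) (I ⊕ I) ℂ :=
      fromBlocks 0 (-Complex.I • 1) (Complex.I • 1) 0
    let Γ₁ : Fin (2 * n + 1) → Matrix (I ⊕ I) (I ⊕ I) ℂ :=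
      Fin.cons x fun i => fromBlocks (Γ i) 0 0 (-Γ i)
    let Γ₂ : Fin (2 * (n + 1)) → Matrix (I ⊕ I) (I ⊕ I) ℂ := Fin.cons (n := 2 * n + 1) y Γ₁
    have hy : ∀ j, y * Γ₁ j = -(Γ₁ j * y) := by
      intro j
      refine Fin.cases ?_ (fun j => ?_) j
      · simp [Γ₁, x, y, fromBlocks_multiply, fromBlocks_neg]
      · simp [Γ₁, y, fromBlocks_multiply, fromBlocks_neg]
    have hx : ∀ j, x * fromBlocks (Γ j) 0 0 (-Γ j) = -(fromBlocks (Γ j) 0 0 (-Γ j) * x) := by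
      intro j
      simp [x, fromBlocks_multiply, fromBlocks_neg]
    refine ⟨I ⊕ I, inferInstance, inferInstance, Γ₂, ?_, ?_, ?_⟩
    · rw [Fintype.card_sum, hcard, pow_succ, mul_two]
    · intro i
      refine Fin.cases (n := 2 * n + 1) ?_ (fun i => Fin.cases ?_ (fun i => ?_) i) i
      · simp [Γ₂, y, fromBlocks_multiply, smul_smul]
      · simp [Γ₂, Γ₁, x, fromBlocks_multiply]
      · simp [Γ₂, Γ₁, fromBlocks_multiply, hsq]
    · intro i j
      refine Fin.cases (n := 2 * n + 1) ?_ (fun i => ?_) i <;>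
        refine Fin.cases (n := 2 * n + 1) ?_ (fun j => ?_) j
      · exact fun h => (h rfl).elim
      · exact fun _ => hy j
      · exact fun _ => by
          change Γ₁ i * y = -(y * Γ₁ i)
          rw [hy, neg_neg]
      · intro h
        have h : j ≠ i := fun e => h (e ▸ rfl)
        change Γ₁ i * Γ₁ j = -(Γ₁ j * Γ₁ i)
        revert h
        refine Fin.cases ?_ (fun i => ?_) i <;> refine Fin.cases ?_ (fun j => ?_) j
        · exact fun h => (h rfl).elim
        · exact fun _ => hx j
        · exact fun _ => by
            change fromBlocks (Γ i) 0 0 (-Γ i) * x = -(x * fromBlocks (Γ i) 0 0 (-Γ i))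
            rw [hx, neg_neg]
        · intro h
          have h : j ≠ i := fun e => h (e ▸ rfl)
          simp [Γ₁, fromBlocks_multiply, fromBlocks_neg, hanti i j h]

theorem trace_eq_zero_of_anticommute {I : Type*} [Fintype I] [DecidableEq I] {g B : Matrix I I ℂ}
    (hg : g * g = 1) (h : g * B = -(B * g)) : B.trace = 0 := by
  have h1 : B.trace = -B.trace := by
    conv_lhs => rw [← one_mul B, ← hg, mul_assoc, h, mul_neg, trace_neg, ← mul_assoc,
      trace_mul_comm, ← mul_assoc, hg, one_mul]
  linear_combination (1 / 2 : ℂ) * h1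

/-- The Clifford relations for the generators in `J` are realised by complex matrices of size
`2^⌈|J|/2⌉` for which every product of distinct generators is traceless.  Such a product
anticommutes with one of its factors if their number is even, and with one of the remaining
members of an even anticommuting family if it is odd; this is why the exponent is rounded up.
Generators outside `J` are sent to `0`. -/
theorem exists_traceless_matrices (J : Finset (Fin (p + q))) :
    ∃ (I : Type) (_ : Fintype I) (_ : DecidableEq I) (γ : Fin (p + q) → Matrix I I ℂ),
      Fintype.card I = numSteps J.card ∧
      (∀ i ∈ J, γ i * γ i = algebraMap ℝ _ (signature p q i)) ∧
      (∀ i j, j ≠ i → γ i * γ j = -(γ j * γ i)) ∧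
      ∀ S, S ≠ ∅ → (bladeProd γ S).trace = 0 := by
  classical
  obtain ⟨I, _, _, Γ, hcard, hsq, hanti⟩ := exists_anticommuting_matrices ((J.card + 1) / 2)
  obtain ⟨σ⟩ : Nonempty (J ↪ Fin (2 * ((J.card + 1) / 2))) :=
    Function.Embedding.nonempty_of_card_le (by simp; omega)
  let u : Fin (p + q) → ℂ := fun i => if (i : ℕ) < p then 1 else Complex.I
  have hu : ∀ i, u i * u i = (signature p q i : ℂ) := by
    intro i; simp only [u, signature]; split_ifs <;> simp
  let γ : Fin (p + q) → Matrix I I ℂ := fun i => if h : i ∈ J then u i • Γ (σ ⟨i, h⟩) else 0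
  have hγ : ∀ i (h : i ∈ J), γ i = u i • Γ (σ ⟨i, h⟩) := fun i h => dif_pos h
  have hγ0 : ∀ i, i ∉ J → γ i = 0 := fun i h => dif_neg h
  refine ⟨I, inferInstance, inferInstance, γ, hcard, fun i hi => ?_, fun i j hij => ?_,
    fun S hS => ?_⟩
  · rw [hγ i hi, smul_mul_smul_comm, hsq, hu]
    ext a b
    simp [Matrix.algebraMap_matrix_apply, one_apply]
  · by_cases hi : i ∈ J <;> by_cases hj : j ∈ J
    · have hne : σ ⟨j, hj⟩ ≠ σ ⟨i, hi⟩ := fun e => hij (congrArg Subtype.val (σ.injective e))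
      rw [hγ i hi, hγ j hj, smul_mul_smul_comm, smul_mul_smul_comm, hanti _ _ hne, mul_comm,
        smul_neg]
    · simp [hγ0 j hj]
    · simp [hγ0 i hi]
    · simp [hγ0 i hi]
  · by_cases hSJ : S ⊆ J
    swap
    · obtain ⟨i, hi, hiJ⟩ := Finset.not_subset.1 hSJ
      rw [bladeProd_eq_zero γ hi (hγ0 i hiJ), trace_zero]
    have hcomm : ∀ t, ∀ i (hi : i ∈ J), Γ t * γ i =
        (if σ ⟨i, hi⟩ = t then (1 : ℝ) else -1) • (γ i * Γ t) := by
      intro t i hi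
      rw [hγ i hi]
      split_ifs with h
      · rw [h, one_smul, mul_smul_comm, smul_mul_assoc]
      · rw [mul_smul_comm, smul_mul_assoc, hanti t _ h, neg_smul, one_smul, smul_neg]
    rcases Nat.even_or_odd S.card with hev | hodd
    · obtain ⟨i₀, hi₀⟩ := Finset.nonempty_iff_ne_empty.2 hS
      refine trace_eq_zero_of_anticommute (hsq (σ ⟨i₀, hSJ hi₀⟩)) ?_
      rw [mul_bladeProd_comm γ _ (fun i => if i = i₀ then (1 : ℝ) else -1) S fun i hi => ?_]
      · rw [← Finset.mul_prod_erase _ _ hi₀, if_pos rfl, one_mul,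
          Finset.prod_congr rfl fun i hi => if_neg (Finset.ne_of_mem_erase hi),
          Finset.prod_const, Finset.card_erase_of_mem hi₀, Odd.neg_one_pow, neg_smul, one_smul]
        exact Nat.Even.sub_odd (Finset.card_pos.2 ⟨i₀, hi₀⟩) hev odd_one
      · rw [hcomm _ i (hSJ hi)]
        simp [σ.injective.eq_iff]
    · obtain ⟨t, ht⟩ : ∃ t, t ∉ S.attach.image fun i : {x // x ∈ S} =>
          σ ⟨i.1, hSJ i.2⟩ := by
        by_contra! h
        have h1 := Finset.card_le_card (fun t _ => h t : Finset.univ ⊆ _)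
        have h2 := h1.trans Finset.card_image_le
        have h3 := Finset.card_le_card hSJ
        obtain ⟨r, hr⟩ := hodd
        simp at h2
        omega
      refine trace_eq_zero_of_anticommute (hsq t) ?_
      rw [mul_bladeProd_comm γ _ (fun _ => (-1 : ℝ)) S fun i hi => ?_]
      · rw [Finset.prod_const, hodd.neg_one_pow, neg_smul, one_smul]
      · rw [hcomm t i (hSJ hi), if_neg]
        rintro rfl
        exact ht (Finset.mem_image.2 ⟨⟨i, hi⟩, Finset.mem_attach _ _, rfl⟩)

/-! ### The complex representation -/

/-- The linear map that sends the blade `e_S` to the ordered product of the `γ i`, `i ∈ S`. -/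
noncomputable def bladeMap {R : Type*} [Ring R] [Algebra ℝ R] (γ : Fin (p + q) → R) :
    Cl p q →ₗ[ℝ] R :=
  (bladeBasis p q).constr ℝ (bladeProd γ)

section BladeMap

variable {R : Type*} [Ring R] [Algebra ℝ R] (γ : Fin (p + q) → R)

theorem bladeMap_blade (S : Finset (Fin (p + q))) : bladeMap γ (blade S) = bladeProd γ S := by
  rw [bladeMap, ← bladeBasis_apply, Module.Basis.constr_basis]

@[simp] theorem bladeMap_one : bladeMap γ 1 = 1 := by
  rw [← blade_empty, bladeMap_blade, bladeProd_empty]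

/-- If the Clifford relations hold for the generators in `J`, then the map is multiplicative when
the left factor lies in the subalgebra generated by them; the right factor is arbitrary. -/
theorem bladeMap_mul {J : Finset (Fin (p + q))}
    (hsq : ∀ i ∈ J, γ i * γ i = algebraMap ℝ R (signature p q i))
    (hanti : ∀ i j, j ≠ i → γ i * γ j = -(γ j * γ i)) {A : Cl p q} (hA : A ∈ bladeSpan J)
    (X : Cl p q) : bladeMap γ (A * X) = bladeMap γ A * bladeMap γ X := by
  have hgen : ∀ i ∈ J, ∀ Y : Cl p q, bladeMap γ (gen i * Y) = γ i * bladeMap γ Y := by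
    intro i hi
    refine linearMap_ext_blade (f := bladeMap γ ∘ₗ LinearMap.mulLeft ℝ (gen i))
      (g := LinearMap.mulLeft ℝ (γ i) ∘ₗ bladeMap γ) fun S => ?_
    simp only [LinearMap.comp_apply, LinearMap.mulLeft_apply]
    rw [gen_mul_blade, map_smul, bladeMap_blade, bladeMap_blade,
      mul_bladeProd γ _ i (hsq i hi) (hanti i)]
  have hlist : ∀ l : List (Fin (p + q)), (∀ i ∈ l, i ∈ J) →
      bladeMap γ ((l.map gen).prod * X) = (l.map γ).prod * bladeMap γ X := by
    intro l
    induction l with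
    | nil => simp
    | cons i l ih =>
      intro h
      simp only [List.map_cons, List.prod_cons, mul_assoc]
      rw [hgen i (h i (by simp)), ih fun j hj => h j (by simp [hj])]
  induction hA using Submodule.span_induction with
  | mem x hx =>
    obtain ⟨S, hS, rfl⟩ := hx
    rw [bladeMap_blade]
    exact hlist _ fun i hi => hS (by simpa using hi)
  | zero => simp
  | add x y _ _ h1 h2 => rw [add_mul, map_add, h1, h2, map_add, add_mul]
  | smul r x _ h => rw [smul_mul_assoc, map_smul, h, map_smul, smul_mul_assoc]

end BladeMap

section TracelessRep

variable {I : Type*} [Fintype I] [DecidableEq I] {γ : Fin (p + q) → Matrix I I ℂ}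

theorem trace_bladeMap (htr : ∀ S, S ≠ ∅ → (bladeProd γ S).trace = 0) (X : Cl p q) :
    (bladeMap γ X).trace = (Fintype.card I : ℂ) * (scalarPart X : ℂ) := by
  have := linearMap_ext_blade
    (f := (traceLinearMap I ℝ ℂ) ∘ₗ bladeMap γ)
    (g := (LinearMap.mulLeft ℝ (Fintype.card I : ℂ)) ∘ₗ Complex.ofRealCLM.toLinearMap ∘ₗ coeffₗ ∅)
    (fun S => ?_) X
  · exact this
  · simp only [LinearMap.comp_apply, traceLinearMap_apply, LinearMap.mulLeft_apply, coeffₗ_apply,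
      bladeMap_blade, coeff_blade]
    split_ifs with h
    · subst h; simp
    · simp [htr S h]

/-- The map is injective on the subalgebra generated by the `e_i`, `i ∈ J`, because the
coefficient of `e_S` in `X` is, up to sign, the normalised trace of the image of `e_S X`. -/
theorem eq_zero_of_bladeMap_eq_zero [Nonempty I] {J : Finset (Fin (p + q))}
    (hsq : ∀ i ∈ J, γ i * γ i = algebraMap ℝ _ (signature p q i))
    (hanti : ∀ i j, j ≠ i → γ i * γ j = -(γ j * γ i))
    (htr : ∀ S, S ≠ ∅ → (bladeProd γ S).trace = 0) {X : Cl p q} (hX : X ∈ bladeSpan J)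
    (h : bladeMap γ X = 0) : X = 0 := by
  rw [← sum_coeff_smul_blade X]
  refine Finset.sum_eq_zero fun S _ => ?_
  by_cases hS : S ⊆ J
  swap
  · rw [coeff_eq_zero_of_mem_bladeSpan hX hS, zero_smul]
  have h1 := trace_bladeMap htr (blade S * X)
  rw [bladeMap_mul γ hsq hanti (blade_mem_bladeSpan hS), h, mul_zero, trace_zero,
    scalarPart_blade_mul] at h1
  have h2 := (blade_mul_self S (p := p) (q := q)).2
  have h3 : scalarPart (blade S * blade S : Cl p q) ≠ 0 := fun h0 => by simp [h0] at h2
  have h4 : coeff S X = 0 := by simpa [h3] using h1.symm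
  rw [h4, zero_smul]

end TracelessRep

/-! ### The real matrices `π_K(A)` -/

/-- Since `e_M² = ⟨e_M e_M⟩₀ = ±1`, the relation `e_M e_L = c e_S` is equivalent to
`e_M e_S = c e_M² e_L`. -/
theorem scalarPart_mul_coeff_blade_mul (M L S : Finset (Fin (p + q))) :
    scalarPart (blade M * blade M : Cl p q) * coeff S (blade M * blade L : Cl p q) =
      coeff L (blade M * blade S : Cl p q) := by
  obtain ⟨c, hc, h⟩ := exists_blade_mul_blade M L (p := p) (q := q)
  obtain ⟨c', -, h'⟩ := exists_blade_mul_blade M S (p := p) (q := q)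
  obtain ⟨hd, -⟩ := blade_mul_self M (p := p) (q := q)
  generalize scalarPart (blade M * blade M : Cl p q) = d at hd ⊢
  by_cases hS : M ∆ L = S
  · have hsq : (c • (blade M * blade S) : Cl p q) = d • blade L := by
      rw [← mul_smul_comm, ← hS, ← h, ← mul_assoc, hd, ← Algebra.smul_def]
    have := congrArg (coeff L) hsq
    rw [coeff_smul, coeff_smul, coeff_blade, if_pos rfl] at this
    rw [h, coeff_smul, coeff_blade, if_pos hS]
    linear_combination (coeff L (blade M * blade S : Cl p q)) * hc - c * this
  · have hL : M ∆ S ≠ L := by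
      rintro rfl
      exact hS (symmDiff_symmDiff_cancel_left M S)
    rw [h, h', coeff_smul, coeff_smul, coeff_blade, coeff_blade, if_neg hS, if_neg hL]
    simp

/-- The matrix `π_K(A)` describes right multiplication by `A` in the basis of blades. -/
theorem matrixRep_apply (K : Finset (Fin (p + q))) (A : Cl p q) (M L : K.powerset) :
    matrixRep K A M L = coeff L (blade (M : Finset (Fin (p + q))) * A) := by
  have hentry : ∀ S, (scalarProductMatrix K * coeffMatrix K S : Matrix _ _ ℝ) M L =
      coeff L (blade (M : Finset (Fin (p + q))) * blade S : Cl p q) := by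
    intro S
    rw [mul_apply, Finset.sum_eq_single M]
    · exact scalarPart_mul_coeff_blade_mul (p := p) (q := q) _ _ _
    · intro N _ hN
      have hN : (N : Finset (Fin (p + q))) ≠ M := fun h => hN (Subtype.ext h)
      simp only [scalarProductMatrix, of_apply]
      rw [scalarPart_blade_mul, coeff_blade, if_neg hN]
      simp
    · simp
  rw [matrixRep, Matrix.sum_apply]
  simp only [Matrix.smul_apply, hentry, smul_eq_mul, ← coeff_smul, ← mul_smul_comm]
  conv_rhs => rw [← sum_coeff_smul_blade A, Finset.mul_sum]
  exact (map_sum (coeffₗ (L : Finset (Fin (p + q)))) _ _).symm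

/-- Only the left factor has to lie in the span of the blades with indices in `K`. -/
theorem matrixRep_mul {K : Finset (Fin (p + q))} {A : Cl p q} (hA : A ∈ bladeSpan K)
    (B : Cl p q) : matrixRep K (A * B) = matrixRep K A * matrixRep K B := by
  ext M L
  rw [mul_apply]
  simp only [matrixRep_apply]
  have hMA : blade (M : Finset (Fin (p + q))) * A ∈ bladeSpan K :=
    mul_mem_bladeSpan (blade_mem_bladeSpan (Finset.mem_powerset.1 M.2)) hA
  rw [← mul_assoc]
  generalize blade (M : Finset (Fin (p + q))) * A = Y at hMA
  have hY : Y = ∑ N : K.powerset, coeff (N : Finset (Fin (p + q))) Y • blade (N : Finset _) := by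
    rw [Finset.sum_coe_sort K.powerset fun N => coeff N Y • (blade N : Cl p q)]
    conv_lhs => rw [← sum_coeff_smul_blade Y]
    refine (Finset.sum_subset (Finset.subset_univ _) fun N _ hN => ?_).symm
    rw [coeff_eq_zero_of_mem_bladeSpan hMA (by simpa using hN), zero_smul]
  conv_lhs => rw [hY, Finset.sum_mul]
  simp only [smul_mul_assoc, ← coeff_smul]
  exact map_sum (coeffₗ (L : Finset (Fin (p + q)))) _ _

theorem matrixRep_one (K : Finset (Fin (p + q))) : matrixRep K (1 : Cl p q) = 1 := by
  ext M L
  rw [matrixRep_apply, mul_one, coeff_blade, one_apply]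
  exact if_congr Subtype.coe_inj rfl rfl

theorem matrixRep_pow {K : Finset (Fin (p + q))} {A : Cl p q} (hA : A ∈ bladeSpan K) (j : ℕ) :
    matrixRep K (A ^ j) = matrixRep K A ^ j := by
  induction j with
  | zero => rw [pow_zero, pow_zero, matrixRep_one]
  | succ j ih => rw [pow_succ', pow_succ', matrixRep_mul hA, ih]

theorem trace_matrixRep (K : Finset (Fin (p + q))) (X : Cl p q) :
    (matrixRep K X).trace = 2 ^ K.card * scalarPart X := by
  have h : ∀ M : K.powerset, (matrixRep K X).diag M = scalarPart X := fun M => by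
    rw [diag_apply, matrixRep_apply, coeff_blade_mul_self]
  rw [Matrix.trace, Finset.sum_congr rfl fun M _ => h M, Finset.sum_const, Finset.card_univ,
    Fintype.card_coe, Finset.card_powerset, nsmul_eq_mul]
  push_cast
  rfl

/-! ### The recursion in the Clifford algebra -/

theorem commute_fvsM (k : ℕ) (A : Cl p q) (j : ℕ) : Commute A (fvsM k A j) := by
  induction j with
  | zero => exact Commute.one_right A
  | succ j ih =>
    exact ((Commute.refl A).mul_right ih).sub_right (Algebra.commute_algebraMap_right _ _)

theorem fvsM_mem_bladeSpan {J : Finset (Fin (p + q))} {A : Cl p q} (hA : A ∈ bladeSpan J)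
    (k j : ℕ) : fvsM k A j ∈ bladeSpan J := by
  induction j with
  | zero => exact one_mem_bladeSpan J
  | succ j ih =>
    rw [fvsM, Algebra.algebraMap_eq_smul_one]
    exact sub_mem (mul_mem_bladeSpan hA ih) (Submodule.smul_mem _ _ (one_mem_bladeSpan J))

theorem fvsM_succ (k : ℕ) (A : Cl p q) (j : ℕ) :
    fvsM k A (j + 1) = A * fvsM k A j + algebraMap ℝ _ (fvsC k A (j + 1)) := by
  rw [fvsM, fvsC, map_neg, sub_eq_add_neg]

theorem coeff_fvsPoly (k : ℕ) (A : Cl p q) (i : ℕ) :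
    (fvsPoly k A).coeff i = if i ≤ k then fvsC k A (k - i) else 0 := by
  rw [fvsPoly, ← Finset.sum_range_reflect, finsetSum_coeff]
  simp only [coeff_C_mul, coeff_X_pow, mul_ite, mul_one, mul_zero]
  have h : ∀ j ∈ Finset.range (k + 1), (if i = k - (k + 1 - 1 - j) then
      fvsC k A (k + 1 - 1 - j) else 0) = if i = j then fvsC k A (k - j) else 0 := by
    intro j hj
    rw [Finset.mem_range] at hj
    rw [show k - (k + 1 - 1 - j) = j by omega, show k + 1 - 1 - j = k - j by omega]
  rw [Finset.sum_congr rfl h, Finset.sum_ite_eq]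
  simp

section TracelessRep

variable {I : Type*} [Fintype I] [DecidableEq I] {γ : Fin (p + q) → Matrix I I ℂ}
  {J : Finset (Fin (p + q))}

/-- The representation carries the recursion in the Clifford algebra to the Faddeev–LeVerrier
recursion, because `k ⟨X⟩₀` is the trace of the image of `X`. -/
theorem bladeMap_fvsM (hsq : ∀ i ∈ J, γ i * γ i = algebraMap ℝ _ (signature p q i))
    (hanti : ∀ i j, j ≠ i → γ i * γ j = -(γ j * γ i))
    (htr : ∀ S, S ≠ ∅ → (bladeProd γ S).trace = 0) {A : Cl p q} (hA : A ∈ bladeSpan J) (j : ℕ) :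
    bladeMap γ (fvsM (Fintype.card I) A j) = leverrier (bladeMap γ A) j := by
  induction j with
  | zero => exact bladeMap_one γ
  | succ j ih =>
    rw [fvsM, leverrier, map_sub, bladeMap_mul γ hsq hanti hA, ih, ← ih,
      ← bladeMap_mul γ hsq hanti hA, trace_bladeMap htr, Algebra.algebraMap_eq_smul_one, map_smul,
      bladeMap_one, Algebra.algebraMap_eq_smul_one, ← Complex.coe_smul]
    congr 2
    push_cast
    ring

theorem ofReal_fvsC (hsq : ∀ i ∈ J, γ i * γ i = algebraMap ℝ _ (signature p q i))
    (hanti : ∀ i j, j ≠ i → γ i * γ j = -(γ j * γ i))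
    (htr : ∀ S, S ≠ ∅ → (bladeProd γ S).trace = 0) {A : Cl p q} (hA : A ∈ bladeSpan J) (j : ℕ) :
    (fvsC (Fintype.card I) A (j + 1) : ℂ) =
      -(((j + 1 : ℕ) : ℂ)⁻¹ * (bladeMap γ A * leverrier (bladeMap γ A) j).trace) := by
  rw [← bladeMap_fvsM hsq hanti htr hA, ← bladeMap_mul γ hsq hanti hA, trace_bladeMap htr, fvsC]
  push_cast
  ring

theorem map_fvsPoly (hsq : ∀ i ∈ J, γ i * γ i = algebraMap ℝ _ (signature p q i))
    (hanti : ∀ i j, j ≠ i → γ i * γ j = -(γ j * γ i))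
    (htr : ∀ S, S ≠ ∅ → (bladeProd γ S).trace = 0) {A : Cl p q} (hA : A ∈ bladeSpan J) :
    (fvsPoly (Fintype.card I) A).map (algebraMap ℝ ℂ) = (bladeMap γ A).charpoly := by
  ext i
  rw [coeff_map, coeff_fvsPoly]
  have hmonic := (bladeMap γ A).charpoly_monic
  have hdeg := (bladeMap γ A).charpoly_natDegree_eq_dim
  rcases lt_trichotomy i (Fintype.card I) with hi | rfl | hi
  · obtain ⟨j, hj⟩ : ∃ j, Fintype.card I - i = j + 1 := ⟨Fintype.card I - i - 1, by omega⟩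
    rw [if_pos hi.le, hj, Complex.coe_algebraMap, ofReal_fvsC hsq hanti htr hA,
      ← (leverrier_spec (bladeMap γ A)).1 j (by omega), ← hj, Nat.sub_sub_self hi.le]
  · have := hmonic.coeff_natDegree
    rw [hdeg] at this
    simp [this, fvsC]
  · rw [if_neg hi.not_ge, coeff_eq_zero_of_natDegree_lt (hdeg ▸ hi), map_zero]

/-- Over `ℂ`, the matrix `π_K(A)` and the block diagonal matrix with `2^|K| / k` copies of the
image of `A` have powers with equal traces, hence the same characteristic polynomial. -/
theorem charpoly_matrixRep (hcard : Fintype.card I = numSteps J.card)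
    (hsq : ∀ i ∈ J, γ i * γ i = algebraMap ℝ _ (signature p q i))
    (hanti : ∀ i j, j ≠ i → γ i * γ j = -(γ j * γ i))
    (htr : ∀ S, S ≠ ∅ → (bladeProd γ S).trace = 0) {A : Cl p q} (hA : A ∈ bladeSpan J)
    {K : Finset (Fin (p + q))} (hK : J ⊆ K) :
    (matrixRep K A).charpoly =
      fvsPoly (Fintype.card I) A ^ (2 ^ K.card / numSteps J.card) := by
  have hdvd : numSteps J.card ∣ 2 ^ K.card :=
    pow_dvd_pow 2 (by have := Finset.card_le_card hK; omega)
  have hpow : ∀ j, A ^ j ∈ bladeSpan J ∧ bladeMap γ (A ^ j) = bladeMap γ A ^ j := by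
    intro j
    induction j with
    | zero => exact ⟨by simpa using one_mem_bladeSpan J, by simp⟩
    | succ j ih =>
      rw [pow_succ', pow_succ', bladeMap_mul γ hsq hanti hA, ih.2]
      exact ⟨mul_mem_bladeSpan hA ih.1, rfl⟩
  refine map_injective (algebraMap ℝ ℂ) (algebraMap ℝ ℂ).injective ?_
  rw [Polynomial.map_pow, map_fvsPoly hsq hanti htr hA, ← charpoly_map]
  conv_rhs => rw [← Fintype.card_fin (2 ^ K.card / numSteps J.card), ← charpoly_blockDiagonal_const]
  refine charpoly_eq_of_trace_pow_eq _ _ fun j => ?_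
  have h1 : ((matrixRep K A).map (algebraMap ℝ ℂ) ^ j).trace =
      ((2 ^ K.card * scalarPart (A ^ j) : ℝ) : ℂ) := by
    rw [← trace_matrixRep, matrixRep_pow (bladeSpan_mono hK hA), ← Matrix.map_pow]
    exact (AddMonoidHom.map_trace (algebraMap ℝ ℂ : ℝ →+ ℂ) _).symm
  have h2 : ((2 ^ K.card / numSteps J.card : ℕ) : ℂ) * numSteps J.card = 2 ^ K.card := by
    exact_mod_cast Nat.div_mul_cancel hdvd
  rw [h1, ← blockDiagonal_pow, trace_blockDiagonal]
  simp only [Pi.pow_apply, ← (hpow j).2, trace_bladeMap htr, hcard, Finset.sum_const,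
    Finset.card_univ, Fintype.card_fin, nsmul_eq_mul]
  rw [← mul_assoc, h2]
  push_cast
  ring

end TracelessRep

end CliffordFVS

theorem theorem4p1 (p q : ℕ) (A : CliffordFVS.Cl p q) (J : Finset (Fin (p + q)))
    (hJ : CliffordFVS.generators A ⊆ J) (k : ℕ) (hk : k = CliffordFVS.numSteps J.card) :
    CliffordFVS.fvsM k A k = 0 ∧
    CliffordFVS.IsReducedCharpoly J A (CliffordFVS.fvsPoly k A) ∧
    (∀ K : Finset (Fin (p + q)), J ⊆ K →
      (CliffordFVS.matrixRep K A).det = ((-1) ^ k * CliffordFVS.fvsC k A k) ^ (2 ^ K.card / k)) ∧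
    (IsUnit A ↔ CliffordFVS.fvsC k A k ≠ 0) ∧
    (CliffordFVS.fvsC k A k ≠ 0 →
      A * -((CliffordFVS.fvsC k A k)⁻¹ • CliffordFVS.fvsM k A (k - 1)) = 1 ∧
      -((CliffordFVS.fvsC k A k)⁻¹ • CliffordFVS.fvsM k A (k - 1)) * A = 1 ∧
      ∀ j < k, CliffordFVS.fvsM k A j ≠ 0) := by
  have hA := CliffordFVS.mem_bladeSpan_of_generators_subset hJ
  obtain ⟨I, _, _, γ, hcard, hsq, hanti, htr⟩ := CliffordFVS.exists_traceless_matrices J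
  obtain rfl : k = Fintype.card I := hk.trans hcard.symm
  set k := Fintype.card I with hkI
  have hkpos : 0 < k := hk ▸ pow_pos two_pos _
  have : Nonempty I := Fintype.card_pos_iff.1 hkpos
  obtain ⟨n, hn⟩ : ∃ n, k = n + 1 := ⟨k - 1, by omega⟩
  have hmk : CliffordFVS.fvsM k A k = 0 := by
    refine CliffordFVS.eq_zero_of_bladeMap_eq_zero hsq hanti htr
      (CliffordFVS.fvsM_mem_bladeSpan hA _ _) ?_
    rw [CliffordFVS.bladeMap_fvsM hsq hanti htr hA]
    exact (CliffordFVS.leverrier_spec _).2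
  have hmap := CliffordFVS.map_fvsPoly hsq hanti htr hA
  have hmonic : (CliffordFVS.fvsPoly k A).Monic :=
    Polynomial.monic_of_injective (algebraMap ℝ ℂ).injective
      (hmap ▸ Matrix.charpoly_monic _)
  have hdeg : (CliffordFVS.fvsPoly k A).natDegree = k := by
    rw [← Polynomial.natDegree_map (algebraMap ℝ ℂ), hmap, Matrix.charpoly_natDegree_eq_dim]
  have hchar := fun (K : Finset (Fin (p + q))) (hK : J ⊆ K) =>
    CliffordFVS.charpoly_matrixRep hcard hsq hanti htr hA hK
  have hconst : (CliffordFVS.fvsPoly k A).coeff 0 = CliffordFVS.fvsC k A k := by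
    simp [CliffordFVS.coeff_fvsPoly]
  have hAm : A * CliffordFVS.fvsM k A (k - 1) = -algebraMap ℝ _ (CliffordFVS.fvsC k A k) := by
    have h := CliffordFVS.fvsM_succ k A n
    rw [← hn, hmk] at h
    rw [show k - 1 = n by omega]
    exact eq_neg_of_add_eq_zero_left h.symm
  have hinv : CliffordFVS.fvsC k A k ≠ 0 →
      A * -((CliffordFVS.fvsC k A k)⁻¹ • CliffordFVS.fvsM k A (k - 1)) = 1 := by
    intro hc
    rw [mul_neg, mul_smul_comm, hAm, smul_neg, neg_neg, Algebra.algebraMap_eq_smul_one, smul_smul,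
      inv_mul_cancel₀ hc, one_smul]
  have hinv' : CliffordFVS.fvsC k A k ≠ 0 →
      -((CliffordFVS.fvsC k A k)⁻¹ • CliffordFVS.fvsM k A (k - 1)) * A = 1 := by
    intro hc
    rw [neg_mul, smul_mul_assoc, ← (CliffordFVS.commute_fvsM k A (k - 1)).eq, ← mul_smul_comm,
      ← mul_neg, hinv hc]
  refine ⟨hmk, ⟨hmonic, hdeg.trans hk, hchar⟩, fun K hK => ?_, ⟨?_, ?_⟩, fun hc =>
    ⟨hinv hc, hinv' hc, fun j hj hzero => ?_⟩⟩
  · have hdvd : CliffordFVS.numSteps J.card ∣ 2 ^ K.card :=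
      pow_dvd_pow 2 (by have := Finset.card_le_card hK; omega)
    rw [Matrix.det_eq_sign_charpoly_coeff, hchar K hK, ← hk, Fintype.card_coe,
      Finset.card_powerset, Polynomial.coeff_zero_eq_eval_zero, Polynomial.eval_pow,
      ← Polynomial.coeff_zero_eq_eval_zero, hconst, mul_pow, ← pow_mul,
      Nat.mul_div_cancel' (hk ▸ hdvd)]
  · -- The image of `A` has a right inverse, since only the left factor of a product has to lie
    -- in the subalgebra for the map to be multiplicative.
    rintro hu hc
    obtain ⟨B, hB⟩ := hu.exists_right_inv
    have h1 : CliffordFVS.bladeMap γ A * CliffordFVS.bladeMap γ B = 1 := by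
      rw [← CliffordFVS.bladeMap_mul γ hsq hanti hA, hB, CliffordFVS.bladeMap_one]
    have h2 : (CliffordFVS.bladeMap γ A).det = 0 := by
      rw [Matrix.det_eq_sign_charpoly_coeff, ← hmap, Polynomial.coeff_map, hconst, hc]
      simp
    have h3 := congrArg Matrix.det h1
    rw [Matrix.det_mul, h2, zero_mul, Matrix.det_one] at h3
    exact zero_ne_one h3
  · exact fun hc => ⟨⟨A, _, hinv hc, hinv' hc⟩, rfl⟩
  · -- Once the recursion reaches `0` it stays there, so `m_{k-1}` would vanish.
    have hstay : ∀ d, CliffordFVS.fvsM k A (j + d) = 0 := by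
      intro d
      induction d with
      | zero => exact hzero
      | succ d ih =>
        have h0 : CliffordFVS.scalarPart (0 : CliffordFVS.Cl p q) = 0 :=
          map_zero (CliffordFVS.coeffₗ ∅)
        rw [← add_assoc, CliffordFVS.fvsM, ih, mul_zero, h0, mul_zero, map_zero, sub_zero]
    have h := hinv hc
    rw [show k - 1 = j + (k - 1 - j) by omega, hstay, smul_zero, neg_zero, mul_zero] at h
    have h' := congrArg CliffordFVS.scalarPart h
    rw [CliffordFVS.scalarPart_one] at h'
    exact zero_ne_one ((map_zero (CliffordFVS.coeffₗ ∅)).symm.trans h')
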